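/- Proposition. The ring $R=\mathbb{C}[x_1,\dots,x_5]/(x_1x_2+x_3x_4-x_5^2)$, the coordinate ring of the quadric in five variables, is a direct summand of a regular ring. That is, there exist a regular ring $S$ (a commutative Noetherian ring all of whose localizations at prime ideals are regular local rings), an injective ring homomorphism $R\hookrightarrow S$, and an $R$-linear map $\sigma\colon S\to R$ whose restriction to $R$ is the identity. -/

import Mathlib

universe u

/-- The ring inclusion `R → S` given by the algebra structure is a direct summand: it is injective
and has an `R`-linear splitting `σ : S → R`. -/
def IsDirectSummandInclusion (R S : Type u) [CommRing R] [CommRing S] [Algebra R S] : Prop :=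
  Function.Injective (algebraMap R S) ∧
    ∃ σ : S →ₗ[R] R, ∀ r : R, σ (algebraMap R S r) = r

/-- `R` is a direct summand of a regular ring: there is a regular ring `S` (Noetherian, with all
localizations at primes regular local) and a ring inclusion of `R` into `S` that is a direct
summand. -/
def IsDirectSummandOfRegularRing (R : Type u) [CommRing R] : Prop :=
  ∃ (S : Type u) (_ : CommRing S) (_ : Algebra R S),
    IsRegularRing S ∧ IsDirectSummandInclusion R S

/-- The ring `ℂ[x₁, …, x₅] / (x₁x₂ + x₃x₄ - x₅²)`; the variables are indexed from `0` to `4`. -/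
abbrev FiveVariableQuadric : Type :=
  MvPolynomial (Fin 5) ℂ ⧸
    Ideal.span
      ({MvPolynomial.X 0 * MvPolynomial.X 1 + MvPolynomial.X 2 * MvPolynomial.X 3
        - MvPolynomial.X 4 ^ 2} : Set (MvPolynomial (Fin 5) ℂ))

/-! The quadric is a ring of invariants of a reductive group, and invariants split off. Let the
group of `2 × 2` matrices of determinant `±1` act on pairs `(A, N)`, `N` symmetric, by `(gA,
g⁻ᵀNg⁻¹)`. The entries of `AᵀNA`, together with `det N` and `-(det A)²`, are invariant, and `det
(AᵀNA) = (det A)² det N` is the equation of the quadric. The ambient `S` is the polynomial ring in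
the seven coordinates.

The Reynolds operator is replaced by linear algebra. The nilpotent generators `raising` and
`lowering` of `sl₂` are adjoint for a Fischer inner product, so `S` is the direct sum of the sum of
their ranges and of their common kernel. That kernel is generated by the expected invariants
(`exists_invariants_eq`): they are separated on the slice `A = diag(1, a)` up to a power of `det A`,
which is then cancelled. The kernel is in turn `R ⊕ det A · R`, where `diag(1, -1)` acts by `±1`.
Both generators are `R`-linear derivations, so `im raising + im lowering + det A · R` is an
`R`-submodule complementary to `R`. -/

open MvPolynomial ComplexConjugate

/-! ### Fischer inner product and adjoint operators. -/

namespace MvPolynomial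

variable {σ : Type*}

/-- The squared norm of the monomial with exponent `m` for the Fischer inner product with
weights `c`. -/
noncomputable def fischerWeight [Fintype σ] (c : σ → ℝ) (m : σ →₀ ℕ) : ℝ :=
  ∏ i, ((m i).factorial : ℝ) * c i ^ m i

theorem fischerWeight_pos [Fintype σ] {c : σ → ℝ} (hc : ∀ i, 0 < c i) (m : σ →₀ ℕ) :
    0 < fischerWeight c m :=
  Finset.prod_pos fun i _ => mul_pos (by exact_mod_cast Nat.factorial_pos _) (pow_pos (hc i) _)

theorem fischerWeight_add_single [Fintype σ] (c : σ → ℝ) (m : σ →₀ ℕ) (i : σ) :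
    fischerWeight c (m + Finsupp.single i 1) = c i * (m i + 1) * fischerWeight c m := by
  classical
  unfold fischerWeight
  rw [← Finset.mul_prod_erase _ _ (Finset.mem_univ i),
    ← Finset.mul_prod_erase (a := i) _ _ (Finset.mem_univ i)]
  have : ∏ x ∈ Finset.univ.erase i,
      (((m + Finsupp.single i 1 : σ →₀ ℕ) x).factorial : ℝ) *
        c x ^ (m + Finsupp.single i 1 : σ →₀ ℕ) x =
      ∏ x ∈ Finset.univ.erase i, ((m x).factorial : ℝ) * c x ^ m x := by
    refine Finset.prod_congr rfl fun x hx => ?_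
    have hx' : i ≠ x := (Finset.ne_of_mem_erase hx).symm
    simp [hx']
  rw [this]
  simp only [Finsupp.add_apply, Finsupp.single_eq_same, Nat.factorial_succ, pow_succ]
  push_cast
  ring

/-- The Fischer inner product on complex polynomials, with weights `c`: monomials are orthogonal,
and the adjoint of the multiplication by a variable is a multiple of the partial derivative. -/
noncomputable def fischer [Fintype σ] (c : σ → ℝ) (f g : MvPolynomial σ ℂ) : ℂ :=
  ∑ m ∈ f.support, (fischerWeight c m : ℂ) * conj (coeff m f) * coeff m g

section Fischer

variable [Fintype σ] (c : σ → ℝ)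

theorem fischer_eq_sum {f : MvPolynomial σ ℂ} (g : MvPolynomial σ ℂ) {s : Finset (σ →₀ ℕ)}
    (hs : f.support ⊆ s) :
    fischer c f g = ∑ m ∈ s, (fischerWeight c m : ℂ) * conj (coeff m f) * coeff m g :=
  Finset.sum_subset hs fun m _ hm => by simp [notMem_support_iff.mp hm]

theorem fischer_conj_symm (f g : MvPolynomial σ ℂ) :
    conj (fischer c g f) = fischer c f g := by
  classical
  rw [fischer_eq_sum c f (Finset.subset_union_right (s₁ := f.support)),
    fischer_eq_sum c g (Finset.subset_union_left (s₂ := g.support)), map_sum]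
  refine Finset.sum_congr rfl fun m _ => ?_
  simp
  ring

theorem fischer_add_right (f g h : MvPolynomial σ ℂ) :
    fischer c f (g + h) = fischer c f g + fischer c f h := by
  simp [fischer, mul_add, Finset.sum_add_distrib]

theorem fischer_smul_right (f g : MvPolynomial σ ℂ) (r : ℂ) :
    fischer c f (r • g) = r * fischer c f g := by
  simp only [fischer, coeff_smul, smul_eq_mul, Finset.mul_sum]
  exact Finset.sum_congr rfl fun m _ => by ring

theorem fischer_add_left (f g h : MvPolynomial σ ℂ) :
    fischer c (f + g) h = fischer c f h + fischer c g h := by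
  rw [← fischer_conj_symm, fischer_add_right, map_add, fischer_conj_symm, fischer_conj_symm]

theorem fischer_smul_left (f g : MvPolynomial σ ℂ) (r : ℂ) :
    fischer c (r • f) g = conj r * fischer c f g := by
  rw [← fischer_conj_symm, fischer_smul_right, map_mul, fischer_conj_symm]

theorem fischer_monomial_left (m : σ →₀ ℕ) (a : ℂ) (g : MvPolynomial σ ℂ) :
    fischer c (monomial m a) g = fischerWeight c m * conj a * coeff m g := by
  classical
  rw [fischer_eq_sum c g support_monomial_subset]
  simp [coeff_monomial]

theorem fischer_X_mul_left (i : σ) (f g : MvPolynomial σ ℂ) :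
    fischer c (X i * f) g = c i * fischer c f (pderiv i g) := by
  induction f using MvPolynomial.induction_on' with
  | monomial m a =>
    have h : X i * monomial m a = monomial (m + Finsupp.single i 1) a := by
      rw [monomial_add_single, pow_one, mul_comm]
    rw [h, fischer_monomial_left, fischer_monomial_left, fischerWeight_add_single, coeff_pderiv]
    push_cast
    ring
  | add p q hp hq => rw [mul_add, fischer_add_left, fischer_add_left, hp, hq, mul_add]

theorem fischer_X_mul_right (i : σ) (f g : MvPolynomial σ ℂ) :
    fischer c f (X i * g) = c i * fischer c (pderiv i f) g := by
  rw [← fischer_conj_symm, fischer_X_mul_left, map_mul, fischer_conj_symm, Complex.conj_ofReal]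

theorem fischer_X_mul_pderiv (i j : σ) (f g : MvPolynomial σ ℂ) :
    c j * fischer c (X i * pderiv j f) g = c i * fischer c f (X j * pderiv i g) := by
  rw [fischer_X_mul_left, fischer_X_mul_right]
  ring

variable {c}

theorem re_fischer_self_eq_sum (f : MvPolynomial σ ℂ) :
    (fischer c f f).re = ∑ m ∈ f.support, fischerWeight c m * Complex.normSq (coeff m f) := by
  rw [fischer, Complex.re_sum]
  refine Finset.sum_congr rfl fun m _ => ?_
  rw [mul_assoc, ← Complex.normSq_eq_conj_mul_self, ← Complex.ofReal_mul, Complex.ofReal_re]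

theorem eq_zero_of_fischer_self (hc : ∀ i, 0 < c i) {f : MvPolynomial σ ℂ}
    (h : fischer c f f = 0) : f = 0 := by
  have h' := re_fischer_self_eq_sum (c := c) f
  rw [h, Complex.zero_re, eq_comm, Finset.sum_eq_zero_iff_of_nonneg fun m _ =>
    mul_nonneg (fischerWeight_pos hc m).le (Complex.normSq_nonneg _)] at h'
  by_contra hf
  obtain ⟨m, hm⟩ := support_nonempty.mpr hf
  have := h' m hm
  simp only [mul_eq_zero, (fischerWeight_pos hc m).ne', false_or, map_eq_zero] at this
  exact mem_support_iff.mp hm this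

/-- The Fischer inner product as an inner product space structure. -/
@[reducible] noncomputable def fischerCore (hc : ∀ i, 0 < c i) :
    InnerProductSpace.Core ℂ (MvPolynomial σ ℂ) where
  inner := fischer c
  conj_inner_symm := fischer_conj_symm c
  re_inner_nonneg f := by
    change 0 ≤ (fischer c f f).re
    rw [re_fischer_self_eq_sum]
    exact Finset.sum_nonneg fun m _ =>
      mul_nonneg (fischerWeight_pos hc m).le (Complex.normSq_nonneg _)
  add_left := fischer_add_left c
  smul_left := fischer_smul_left c
  definite _ := eq_zero_of_fischer_self hc

/-- Polynomials are not complete for this norm, so orthogonal projection is used onto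
finite-dimensional subspaces only. -/
theorem exists_add_fischer_orthogonal (hc : ∀ i, 0 < c i)
    (K : Submodule ℂ (MvPolynomial σ ℂ)) [FiniteDimensional ℂ K] (f : MvPolynomial σ ℂ) :
    ∃ k ∈ K, ∃ h, (∀ g ∈ K, fischer c g h = 0) ∧ f = k + h := by
  let _ : NormedAddCommGroup (MvPolynomial σ ℂ) := (fischerCore hc).toNormedAddCommGroup
  let _ : InnerProductSpace ℂ (MvPolynomial σ ℂ) := InnerProductSpace.ofCore (fischerCore hc).toCore
  obtain ⟨k, hk, h, hh, e⟩ := K.exists_add_mem_mem_orthogonal f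
  exact ⟨k, hk, h, fun g hg => hh g hg, e⟩

/-- If two degree-nonincreasing operators are adjoint for the Fischer inner product, every
polynomial is the sum of elements of their ranges and of an element of both kernels. -/
theorem exists_eq_add_add_of_adjoint (hc : ∀ i, 0 < c i)
    {D D' : MvPolynomial σ ℂ →ₗ[ℂ] MvPolynomial σ ℂ}
    (adj : ∀ f g, fischer c (D f) g = fischer c f (D' g))
    (deg : ∀ n, restrictTotalDegree σ ℂ n ≤ (restrictTotalDegree σ ℂ n).comap D)
    (deg' : ∀ n, restrictTotalDegree σ ℂ n ≤ (restrictTotalDegree σ ℂ n).comap D')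
    (f : MvPolynomial σ ℂ) :
    ∃ g g' h, D h = 0 ∧ D' h = 0 ∧ f = D g + D' g' + h := by
  have adj' : ∀ f g, fischer c (D' f) g = fischer c f (D g) := fun f g => by
    rw [← fischer_conj_symm, ← adj, fischer_conj_symm]
  -- Truncating by degree makes the ranges finite-dimensional. Both operators preserve `W`, so `h`
  -- stays in `W`, and `D' (D h)` and `D (D' h)` lie in the subspace orthogonal to `h`.
  let W := restrictTotalDegree σ ℂ f.totalDegree
  obtain ⟨k, hk, h, hh, e⟩ := exists_add_fischer_orthogonal hc (W.map D ⊔ W.map D') f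
  have hf : f ∈ W := (mem_restrictTotalDegree _ _ _).mpr le_rfl
  have hkW : k ∈ W := (sup_le (Submodule.map_le_iff_le_comap.mpr (deg _))
    (Submodule.map_le_iff_le_comap.mpr (deg' _))) hk
  have hhW : h ∈ W := by
    rw [eq_sub_of_add_eq' e.symm]
    exact W.sub_mem hf hkW
  obtain ⟨_, ⟨g, -, rfl⟩, _, ⟨g', -, rfl⟩, rfl⟩ := Submodule.mem_sup.mp hk
  refine ⟨g, g', h, eq_zero_of_fischer_self hc ?_, eq_zero_of_fischer_self hc ?_, e⟩
  · rw [← adj']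
    exact hh _ (Submodule.mem_sup_right ⟨_, deg _ hhW, rfl⟩)
  · rw [← adj]
    exact hh _ (Submodule.mem_sup_left ⟨_, deg' _ hhW, rfl⟩)

theorem eq_zero_of_adjoint (hc : ∀ i, 0 < c i)
    {D D' : MvPolynomial σ ℂ →ₗ[ℂ] MvPolynomial σ ℂ}
    (adj : ∀ f g, fischer c (D f) g = fischer c f (D' g)) {g g' h : MvPolynomial σ ℂ}
    (hD : D h = 0) (hD' : D' h = 0) (e : h = D g + D' g') : h = 0 := by
  refine eq_zero_of_fischer_self hc ?_
  have h0 : ∀ f : MvPolynomial σ ℂ, fischer c f 0 = 0 := fun f => by simp [fischer]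
  conv_lhs => rw [e]
  rw [fischer_add_left, adj, ← e, hD', h0, zero_add, ← fischer_conj_symm, ← adj, hD,
    ← fischer_conj_symm, h0]
  simp

end Fischer

theorem X_mul_pderiv_mem_restrictTotalDegree (i j : σ) {n : ℕ} {f : MvPolynomial σ ℂ}
    (hf : f ∈ restrictTotalDegree σ ℂ n) : X i * pderiv j f ∈ restrictTotalDegree σ ℂ n := by
  classical
  rw [restrictTotalDegree, restrictSupport_eq_span] at hf
  induction hf using Submodule.span_induction with
  | mem f hf =>
    obtain ⟨m, hm, rfl⟩ := hf
    rw [pderiv_monomial, mem_restrictTotalDegree]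
    by_cases hj : m j = 0
    · simp [hj]
    · refine (totalDegree_mul _ _).trans ?_
      rw [totalDegree_X]
      refine (Nat.add_le_add_left (totalDegree_monomial_le _ _) 1).trans ?_
      have hle : Finsupp.single j 1 ≤ m := by simpa using Nat.one_le_iff_ne_zero.mpr hj
      have h1 := congrArg Finsupp.degree (tsub_add_cancel_of_le hle)
      have hm' : m.degree ≤ n := hm
      rw [map_add, Finsupp.degree_single] at h1
      change 1 + (m - Finsupp.single j 1).degree ≤ n
      omega
  | zero => simp
  | add f g _ _ hf hg => rw [map_add, mul_add]; exact add_mem hf hg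
  | smul a f _ hf =>
    rw [Derivation.map_smul, mul_smul_comm]
    exact Submodule.smul_mem _ _ hf

/-! ### Vanishing on double covers; constancy along integral curves. -/

/-- A polynomial in `n + 1` variables vanishing at the points of the double cover
`z ^ 2 = Q(y)` where `P(y) ≠ 0` is a multiple of `z ^ 2 - Q`. -/
theorem mem_span_of_eval_eq_zero {n : ℕ} {P Q : MvPolynomial (Fin n) ℂ} (hP : P ≠ 0)
    (hQ : Q ≠ 0) (H : MvPolynomial (Fin (n + 1)) ℂ)
    (hH : ∀ (y : Fin n → ℂ) (z : ℂ), z ^ 2 = eval y Q → eval y P ≠ 0 →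
      eval (Fin.snoc y z : Fin (n + 1) → ℂ) H = 0) :
    H ∈ Ideal.span {X (Fin.last n) ^ 2 - rename Fin.castSucc Q} := by
  set I : Ideal (MvPolynomial (Fin (n + 1)) ℂ) :=
    Ideal.span {X (Fin.last n) ^ 2 - rename Fin.castSucc Q} with hI
  have hrel : X (Fin.last n) ^ 2 - rename Fin.castSucc Q ∈ I := Ideal.mem_span_singleton_self _
  -- Division by the monic quadratic in the last variable leaves a remainder `H₀ + z H₁`.
  have division : ∃ H₀ H₁ : MvPolynomial (Fin n) ℂ,
      H - (rename Fin.castSucc H₀ + X (Fin.last n) * rename Fin.castSucc H₁) ∈ I := by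
    clear hH
    induction H using MvPolynomial.induction_on with
    | C a => exact ⟨C a, 0, by simp⟩
    | add p q hp hq =>
      obtain ⟨p₀, p₁, hp⟩ := hp
      obtain ⟨q₀, q₁, hq⟩ := hq
      refine ⟨p₀ + q₀, p₁ + q₁, ?_⟩
      convert I.add_mem hp hq using 1
      simp only [map_add]
      ring
    | mul_X p i hp =>
      obtain ⟨p₀, p₁, hp⟩ := hp
      induction i using Fin.lastCases with
      | last =>
        refine ⟨Q * p₁, p₀, ?_⟩
        convert I.add_mem (I.mul_mem_right (X (Fin.last n)) hp)
          (I.mul_mem_right (rename Fin.castSucc p₁) hrel) using 1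
        simp only [map_mul]
        ring
      | cast i =>
        refine ⟨p₀ * X i, p₁ * X i, ?_⟩
        convert I.mul_mem_right (X i.castSucc) hp using 1
        simp only [map_mul, rename_X]
        ring
  obtain ⟨H₀, H₁, h⟩ := division
  have heval : ∀ (y : Fin n → ℂ) (z : ℂ), z ^ 2 = eval y Q →
      eval (Fin.snoc y z : Fin (n + 1) → ℂ) H = eval y H₀ + z * eval y H₁ := by
    intro y z hz
    obtain ⟨k, hk⟩ := Ideal.mem_span_singleton'.mp h
    have hcomp : ((Fin.snoc y z : Fin (n + 1) → ℂ) ∘ Fin.castSucc) = y := by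
      ext i
      simp
    have := congrArg (eval (Fin.snoc y z : Fin (n + 1) → ℂ)) hk
    simp only [map_mul, map_sub, map_pow, eval_X, map_add, eval_rename, hcomp, Fin.snoc_last, hz,
      sub_self, mul_zero] at this
    exact sub_eq_zero.mp this.symm
  -- Both roots `±z` lie on the cover, which separates `H₀` from `z H₁`; the factor `Q = z²` covers
  -- the case `z = 0`.
  have key : ∀ y : Fin n → ℂ, eval y P ≠ 0 → eval y H₀ = 0 ∧ eval y Q * eval y H₁ = 0 := by
    intro y hy
    obtain ⟨z, hz'⟩ := IsAlgClosed.exists_pow_nat_eq (eval y Q) two_pos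
    have hz := hz'.symm
    have h1 := heval y z hz.symm
    have h2 := heval y (-z) (by rw [neg_sq, hz])
    rw [hH y z hz.symm hy] at h1
    rw [hH y (-z) (by rw [neg_sq, hz]) hy] at h2
    refine ⟨by linear_combination -(h1 + h2) / 2, ?_⟩
    rw [hz]
    linear_combination -z * (h1 - h2) / 2
  have hH₀ : H₀ = 0 := by
    refine (mul_eq_zero.mp (?_ : P * H₀ = 0)).resolve_left hP
    refine MvPolynomial.funext fun y => ?_
    by_cases hy : eval y P = 0
    · simp [hy]
    · simp [(key y hy).1]
  have hH₁ : H₁ = 0 := by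
    refine (mul_eq_zero.mp (?_ : (P * Q) * H₁ = 0)).resolve_left (mul_ne_zero hP hQ)
    refine MvPolynomial.funext fun y => ?_
    by_cases hy : eval y P = 0
    · simp [hy]
    · simp [mul_assoc, (key y hy).2]
  simpa [hH₀, hH₁] using h

/-- A polynomial killed by a derivation is constant along a polynomial curve which is
an integral curve of the derivation. -/
theorem eval_eq_of_derivation_eq_zero {σ : Type*}
    (D : Derivation ℂ (MvPolynomial σ ℂ) (MvPolynomial σ ℂ)) (y : σ → Polynomial ℂ)
    (hy : ∀ i, Polynomial.derivative (y i) = aeval y (D (X i))) {h : MvPolynomial σ ℂ}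
    (hD : D h = 0) (s t : ℂ) :
    eval (fun i => (y i).eval s) h = eval (fun i => (y i).eval t) h := by
  have chain : ∀ f, Polynomial.derivative (aeval y f) = aeval y (D f) := by
    intro f
    induction f using MvPolynomial.induction_on with
    | C a => simp
    | add p q hp hq => simp [hp, hq]
    | mul_X p i hp =>
      rw [map_mul, Polynomial.derivative_mul, hp, aeval_X, hy, Derivation.leibniz, map_add,
        smul_eq_mul, smul_eq_mul, map_mul, map_mul, aeval_X]
      ring
  have h0 : Polynomial.derivative (aeval y h) = 0 := by rw [chain, hD, map_zero]
  have hc := Polynomial.eq_C_of_natDegree_eq_zero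
    (Polynomial.derivative_eq_zero.mp h0)
  have heval : ∀ s : ℂ, eval (fun i => (y i).eval s) h = (aeval y h).eval s := by
    intro s
    have : ((Polynomial.evalRingHom s).comp (aeval y : _ →ₐ[ℂ] _).toRingHom) =
        eval (fun i => (y i).eval s) := by
      ext <;> simp
    exact (RingHom.congr_fun this h).symm
  rw [heval, heval, hc, Polynomial.eval_C, Polynomial.eval_C]

end MvPolynomial

/-! ### The action on pairs and its infinitesimal generators. -/

namespace FiveVariableQuadric

/-- The coordinate ring of the space of pairs `(A, N)`, where `A` is the `2 × 2` matrix with rows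
`(X 0, X 1)` and `(X 2, X 3)`, and `N` is the symmetric matrix with rows `(X 4, X 5)` and
`(X 5, X 6)`. The matrix `g` of determinant `1` acts by `(A, N) ↦ (g A, g⁻ᵀ N g⁻¹)`. -/
abbrev Pairs : Type := MvPolynomial (Fin 7) ℂ

/-- The determinant of `A`. -/
noncomputable def detA : Pairs := X 0 * X 3 - X 1 * X 2

/-- The determinant of `N`. -/
noncomputable def detN : Pairs := X 4 * X 6 - X 5 ^ 2

/-- The first diagonal entry of `Aᵀ N A`. -/
noncomputable def gram₁₁ : Pairs := X 4 * X 0 ^ 2 + 2 * X 5 * X 0 * X 2 + X 6 * X 2 ^ 2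

/-- The off-diagonal entry of `Aᵀ N A`. -/
noncomputable def gram₁₂ : Pairs :=
  X 4 * X 0 * X 1 + X 5 * (X 0 * X 3 + X 1 * X 2) + X 6 * X 2 * X 3

/-- The second diagonal entry of `Aᵀ N A`. -/
noncomputable def gram₂₂ : Pairs := X 4 * X 1 ^ 2 + 2 * X 5 * X 1 * X 3 + X 6 * X 3 ^ 2

theorem gram_det : gram₁₁ * gram₂₂ - gram₁₂ ^ 2 = detA ^ 2 * detN := by
  unfold gram₁₁ gram₂₂ gram₁₂ detA detN
  ring

/-- The infinitesimal action of the upper triangular nilpotent matrix. -/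
noncomputable def raising : Derivation ℂ Pairs Pairs :=
  (X 2 : Pairs) • pderiv 0 + (X 3 : Pairs) • pderiv 1 - (X 4 : Pairs) • pderiv 5
    - (2 * X 5 : Pairs) • pderiv 6

/-- The infinitesimal action of the lower triangular nilpotent matrix. -/
noncomputable def lowering : Derivation ℂ Pairs Pairs :=
  (X 0 : Pairs) • pderiv 2 + (X 1 : Pairs) • pderiv 3 - (2 * X 5 : Pairs) • pderiv 4
    - (X 6 : Pairs) • pderiv 5

theorem raising_apply (f : Pairs) : raising f =
    X 2 * pderiv 0 f + X 3 * pderiv 1 f - X 4 * pderiv 5 f - 2 * (X 5 * pderiv 6 f) := by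
  simp [raising, mul_assoc]

theorem lowering_apply (f : Pairs) : lowering f =
    X 0 * pderiv 2 f + X 1 * pderiv 3 f - 2 * (X 5 * pderiv 4 f) - X 6 * pderiv 5 f := by
  simp [lowering, mul_assoc]

theorem raising_X (i : Fin 7) :
    raising (X i) = (![X 2, X 3, 0, 0, 0, -X 4, -(2 * X 5)] : Fin 7 → Pairs) i := by
  rw [raising_apply]
  fin_cases i <;> simp [pderiv_X]

theorem lowering_X (i : Fin 7) :
    lowering (X i) = (![0, 0, X 0, X 1, -(2 * X 5), -X 6, 0] : Fin 7 → Pairs) i := by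
  rw [lowering_apply]
  fin_cases i <;> simp [pderiv_X]

/-- The weights for which `raising` and `lowering` are adjoint. -/
noncomputable def weights : Fin 7 → ℝ := ![1, 1, 1, 1, 1, 1 / 2, 1]

theorem weights_pos (i : Fin 7) : 0 < weights i := by
  fin_cases i <;> simp [weights]

theorem fischer_raising (f g : Pairs) :
    fischer weights (raising f) g = fischer weights f (lowering g) := by
  have h := fun i j => fischer_X_mul_pderiv weights i j f g
  -- On the `N` coordinates, the weight `1 / 2` of the off-diagonal entry exchanges the coefficients
  -- `1` and `2` under adjunction.
  have h20 := h 2 0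
  have h31 := h 3 1
  have h45 := h 4 5
  have h56 := h 5 6
  simp only [show weights 0 = 1 from rfl, show weights 1 = 1 from rfl, show weights 2 = 1 from rfl,
    show weights 3 = 1 from rfl, show weights 4 = 1 from rfl, show weights 5 = 1 / 2 from rfl,
    show weights 6 = 1 from rfl, Complex.ofReal_one, one_mul, Complex.ofReal_div,
    Complex.ofReal_ofNat] at h20 h31 h45 h56
  have e1 : raising f = X 2 * pderiv 0 f + X 3 * pderiv 1 f + (-1 : ℂ) • (X 4 * pderiv 5 f) +
      (-2 : ℂ) • (X 5 * pderiv 6 f) := by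
    rw [raising_apply, smul_eq_C_mul, smul_eq_C_mul]
    simp only [map_neg, map_one, map_ofNat]
    ring
  have e2 : lowering g = X 0 * pderiv 2 g + X 1 * pderiv 3 g + (-2 : ℂ) • (X 5 * pderiv 4 g) +
      (-1 : ℂ) • (X 6 * pderiv 5 g) := by
    rw [lowering_apply, smul_eq_C_mul, smul_eq_C_mul]
    simp only [map_neg, map_one, map_ofNat]
    ring
  rw [e1, e2]
  simp only [fischer_add_left, fischer_add_right, fischer_smul_left, fischer_smul_right]
  simp only [map_neg, map_one, Complex.conj_ofNat]
  linear_combination h20 + h31 - 2 * h45 - 2 * h56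

theorem raising_mem_restrictTotalDegree (n : ℕ) :
    restrictTotalDegree (Fin 7) ℂ n ≤
      (restrictTotalDegree (Fin 7) ℂ n).comap raising.toLinearMap := by
  intro f hf
  have h := fun i j : Fin 7 => X_mul_pderiv_mem_restrictTotalDegree i j hf
  change raising f ∈ restrictTotalDegree (Fin 7) ℂ n
  rw [raising_apply, two_mul]
  exact sub_mem (sub_mem (add_mem (h _ _) (h _ _)) (h _ _)) (add_mem (h _ _) (h _ _))

theorem lowering_mem_restrictTotalDegree (n : ℕ) :
    restrictTotalDegree (Fin 7) ℂ n ≤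
      (restrictTotalDegree (Fin 7) ℂ n).comap lowering.toLinearMap := by
  intro f hf
  have h := fun i j : Fin 7 => X_mul_pderiv_mem_restrictTotalDegree i j hf
  change lowering f ∈ restrictTotalDegree (Fin 7) ℂ n
  rw [lowering_apply, two_mul]
  exact sub_mem (sub_mem (add_mem (h _ _) (h _ _)) (add_mem (h _ _) (h _ _))) (h _ _)

theorem exists_eq_raising_add_lowering_add (f : Pairs) :
    ∃ g g' h, raising h = 0 ∧ lowering h = 0 ∧ f = raising g + lowering g' + h :=
  exists_eq_add_add_of_adjoint (D := raising.toLinearMap) (D' := lowering.toLinearMap) weights_pos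
    fischer_raising raising_mem_restrictTotalDegree lowering_mem_restrictTotalDegree f

theorem eq_zero_of_eq_raising_add_lowering {g g' h : Pairs} (hr : raising h = 0)
    (hl : lowering h = 0) (e : h = raising g + lowering g') : h = 0 :=
  eq_zero_of_adjoint (D := raising.toLinearMap) (D' := lowering.toLinearMap) weights_pos
    fischer_raising hr hl e

/-! ### Invariants of `SL₂`. -/

/-- The generators of the ring of invariants of `SL₂`. -/
noncomputable def invariants : MvPolynomial (Fin 5) ℂ →ₐ[ℂ] Pairs :=
  aeval ![gram₁₁, gram₂₂, detA, detN, gram₁₂]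

theorem eval_invariants (x : Fin 7 → ℂ) (G : MvPolynomial (Fin 5) ℂ) :
    eval x (invariants G) =
      eval ![eval x gram₁₁, eval x gram₂₂, eval x detA, eval x detN, eval x gram₁₂] G := by
  have : (eval x).comp invariants.toRingHom =
      eval ![eval x gram₁₁, eval x gram₂₂, eval x detA, eval x detN, eval x gram₁₂] := by
    ext i
    · simp
    · fin_cases i <;> simp [invariants]
  exact RingHom.congr_fun this G

theorem pderiv_two (i : Fin 7) : pderiv i (2 : Pairs) = 0 := by
  rw [show (2 : Pairs) = C 2 from (map_ofNat C 2).symm, pderiv_C]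

theorem raising_invariants (G : MvPolynomial (Fin 5) ℂ) : raising (invariants G) = 0 := by
  induction G using MvPolynomial.induction_on with
  | C a => simp [invariants]
  | add p q hp hq => rw [map_add, map_add, hp, hq, add_zero]
  | mul_X p i hp =>
    have : raising (invariants (X i)) = 0 := by
      rw [raising_apply]
      fin_cases i <;>
      simp [invariants, gram₁₁, gram₁₂, gram₂₂, detA, detN, pderiv_X, Derivation.leibniz_pow,
        pderiv_two] <;>
      ring
    rw [map_mul, Derivation.leibniz, hp, this, smul_zero, smul_zero, add_zero]

theorem lowering_invariants (G : MvPolynomial (Fin 5) ℂ) : lowering (invariants G) = 0 := by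
  induction G using MvPolynomial.induction_on with
  | C a => simp [invariants]
  | add p q hp hq => rw [map_add, map_add, hp, hq, add_zero]
  | mul_X p i hp =>
    have : lowering (invariants (X i)) = 0 := by
      rw [lowering_apply]
      fin_cases i <;>
      simp [invariants, gram₁₁, gram₁₂, gram₂₂, detA, detN, pderiv_X, Derivation.leibniz_pow,
        pderiv_two] <;>
      ring
    rw [map_mul, Derivation.leibniz, hp, this, smul_zero, smul_zero, add_zero]

/-- The left-hand points trace the orbit of the upper unipotent one-parameter group, an integral
curve of `raising`. -/
theorem eval_upper {h : Pairs} (hr : raising h = 0) (x₀ x₁ x₂ x₃ x₄ x₅ x₆ t : ℂ) :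
    eval ![x₀ + t * x₂, x₁ + t * x₃, x₂, x₃, x₄, x₅ - t * x₄, x₆ - 2 * t * x₅ + t ^ 2 * x₄] h =
      eval ![x₀, x₁, x₂, x₃, x₄, x₅, x₆] h := by
  have key := eval_eq_of_derivation_eq_zero raising
    (![Polynomial.C x₀ + Polynomial.X * Polynomial.C x₂,
      Polynomial.C x₁ + Polynomial.X * Polynomial.C x₃, Polynomial.C x₂, Polynomial.C x₃,
      Polynomial.C x₄, Polynomial.C x₅ - Polynomial.X * Polynomial.C x₄,
      Polynomial.C x₆ - 2 * Polynomial.X * Polynomial.C x₅ + Polynomial.X ^ 2 * Polynomial.C x₄] : Fin 7 → Polynomial ℂ)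
    (by
      intro i
      rw [raising_X]
      fin_cases i <;> simp <;> ring) hr t 0
  convert key using 2 <;> congr 1 <;> ext i <;> fin_cases i <;> simp <;> ring

theorem eval_lower {h : Pairs} (hl : lowering h = 0) (x₀ x₁ x₂ x₃ x₄ x₅ x₆ t : ℂ) :
    eval ![x₀, x₁, x₂ + t * x₀, x₃ + t * x₁, x₄ - 2 * t * x₅ + t ^ 2 * x₆, x₅ - t * x₆, x₆] h =
      eval ![x₀, x₁, x₂, x₃, x₄, x₅, x₆] h := by
  have key := eval_eq_of_derivation_eq_zero lowering
    (![Polynomial.C x₀, Polynomial.C x₁, Polynomial.C x₂ + Polynomial.X * Polynomial.C x₀,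
      Polynomial.C x₃ + Polynomial.X * Polynomial.C x₁,
      Polynomial.C x₄ - 2 * Polynomial.X * Polynomial.C x₅ + Polynomial.X ^ 2 * Polynomial.C x₆,
      Polynomial.C x₅ - Polynomial.X * Polynomial.C x₆, Polynomial.C x₆] : Fin 7 → Polynomial ℂ)
    (by
      intro i
      rw [lowering_X]
      fin_cases i <;> simp <;> ring) hl t 0
  convert key using 2 <;> congr 1 <;> ext i <;> fin_cases i <;> simp <;> ring

/-- An `SL₂`-invariant is determined by its restriction to the pairs with `A = diag(1, a)`. -/
theorem eval_eq_eval_slice {h : Pairs} (hr : raising h = 0) (hl : lowering h = 0)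
    (x : Fin 7 → ℂ) (h2 : x 2 ≠ 0) (ha : eval x detA ≠ 0) :
    eval x h = eval ![1, 0, 0, eval x detA, eval x gram₁₁, eval x gram₁₂ / eval x detA,
      eval x gram₂₂ / eval x detA ^ 2] h := by
  obtain ⟨x₀, x₁, x₂, x₃, x₄, x₅, x₆, rfl⟩ : ∃ x₀ x₁ x₂ x₃ x₄ x₅ x₆,
      x = ![x₀, x₁, x₂, x₃, x₄, x₅, x₆] :=
    ⟨x 0, x 1, x 2, x 3, x 4, x 5, x 6, by ext i; fin_cases i <;> rfl⟩
  have h2' : x₂ ≠ 0 := h2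
  have ea : eval ![x₀, x₁, x₂, x₃, x₄, x₅, x₆] detA = x₀ * x₃ - x₁ * x₂ := by simp [detA]
  rw [ea] at ha ⊢
  obtain ⟨a, hadef⟩ : ∃ a, a = x₀ * x₃ - x₁ * x₂ := ⟨_, rfl⟩
  rw [← hadef] at ha ⊢
  obtain rfl : x₁ = (x₀ * x₃ - a) / x₂ := by
    field_simp
    linear_combination hadef
  -- Row reduction of `A`: the three unipotents make the corner entry `1`, clear the entry below it,
  -- and clear the entry to its right.
  rw [← eval_upper hr x₀ _ x₂ x₃ x₄ x₅ x₆ ((1 - x₀) / x₂), ← eval_lower hl _ _ _ _ _ _ _ (-x₂),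
    ← eval_upper hr _ _ _ _ _ _ _ (-((x₀ * x₃ - a) / x₂ + (1 - x₀) / x₂ * x₃) / a)]
  congr 2
  ext i
  fin_cases i <;> simp [gram₁₁, gram₁₂, gram₂₂] <;> field_simp <;> ring

/-- The slice coordinates are rational in the invariants, with denominators powers of `det A`; each
variable needs at most a square. -/
theorem exists_eval_eq_pow_mul_eval_slice (h : Pairs) :
    ∃ (k : ℕ) (G : MvPolynomial (Fin 5) ℂ), ∀ y : Fin 5 → ℂ, y 2 ≠ 0 →
      eval y G = y 2 ^ k * eval ![1, 0, 0, y 2, y 0, y 4 / y 2, y 1 / y 2 ^ 2] h := by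
  induction h using MvPolynomial.induction_on with
  | C a => exact ⟨0, C a, by simp⟩
  | add p q hp hq =>
    obtain ⟨k, G, hG⟩ := hp
    obtain ⟨l, H, hH⟩ := hq
    refine ⟨k + l, X 2 ^ l * G + X 2 ^ k * H, fun y hy => ?_⟩
    simp only [map_add, map_mul, map_pow, eval_X, hG y hy, hH y hy]
    ring
  | mul_X p i hp =>
    obtain ⟨k, G, hG⟩ := hp
    refine ⟨k + 2, G * (![X 2 ^ 2, 0, 0, X 2 ^ 3, X 0 * X 2 ^ 2, X 4 * X 2, X 1] :
      Fin 7 → MvPolynomial (Fin 5) ℂ) i, fun y hy => ?_⟩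
    rw [map_mul, hG y hy, map_mul, pow_add, eval_X]
    have : eval y ((![X 2 ^ 2, 0, 0, X 2 ^ 3, X 0 * X 2 ^ 2, X 4 * X 2, X 1] :
        Fin 7 → MvPolynomial (Fin 5) ℂ) i) =
        y 2 ^ 2 * (![1, 0, 0, y 2, y 0, y 4 / y 2, y 1 / y 2 ^ 2] : Fin 7 → ℂ) i := by
      fin_cases i <;> simp <;> field_simp
    rw [this]
    ring

theorem detA_ne_zero : detA ≠ 0 := by
  intro h
  have := congrArg (eval ![1, 0, 0, 1, 0, 0, 0]) h
  simp [detA] at this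

/-- Modulo `det A`, the only relation is `gram₁₁ * gram₂₂ = gram₁₂ ^ 2`, and that difference is
itself `det A` times an invariant. -/
theorem exists_invariants_eq_of_detA_mul {f : Pairs} {G : MvPolynomial (Fin 5) ℂ}
    (h : invariants G = detA * f) : ∃ G', invariants G' = f := by
  let G' : MvPolynomial (Fin 5) ℂ :=
    aeval (![X 0, X 1, 0, X 3, X 4] : Fin 5 → MvPolynomial (Fin 5) ℂ) G
  have h1 : G - G' ∈ Ideal.span {(X 2 : MvPolynomial (Fin 5) ℂ)} := by
    rw [← Ideal.Quotient.eq]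
    have : (Ideal.Quotient.mkₐ ℂ (Ideal.span {(X 2 : MvPolynomial (Fin 5) ℂ)})) =
        (Ideal.Quotient.mkₐ ℂ _).comp
          (aeval (![X 0, X 1, 0, X 3, X 4] : Fin 5 → MvPolynomial (Fin 5) ℂ)) := by
      ext i
      fin_cases i <;> simp
    exact AlgHom.congr_fun this G
  have h2 : G' ∈ Ideal.span {X (Fin.last 4) ^ 2 -
      rename Fin.castSucc (X 0 * X 1 : MvPolynomial (Fin 4) ℂ)} := by
    refine mem_span_of_eval_eq_zero (P := 1) one_ne_zero
      (mul_ne_zero (X_ne_zero 0) (X_ne_zero 1)) _ fun y z hz _ => ?_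
    simp only [map_mul, eval_X] at hz
    obtain ⟨u, v, hu, hv, huv⟩ : ∃ u v : ℂ, u ^ 2 = y 0 ∧ v ^ 2 = y 1 ∧ u * v = z := by
      obtain ⟨u, hu⟩ := IsAlgClosed.exists_pow_nat_eq (y 0) two_pos
      by_cases hu0 : u = 0
      · obtain ⟨v, hv⟩ := IsAlgClosed.exists_pow_nat_eq (y 1) two_pos
        refine ⟨u, v, hu, hv, ?_⟩
        rw [← hu, hu0] at hz
        have : z = 0 := by simpa using hz
        rw [hu0, this, zero_mul]
      · refine ⟨u, z / u, hu, ?_, mul_div_cancel₀ z hu0⟩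
        rw [div_pow, hz, ← hu]
        field_simp
    -- With `A` of rows `(u, v)`, `(0, 0)` and `N = diag(1, y 3)`, the determinant of `A` vanishes
    -- while the other invariants take the prescribed values.
    have e := congrArg (eval ![u, v, 0, 0, 1, 0, y 3]) h
    rw [eval_invariants, map_mul] at e
    have e' : (eval (Fin.snoc y z : Fin 5 → ℂ)).comp
        (aeval (![X 0, X 1, 0, X 3, X 4] : Fin 5 → MvPolynomial (Fin 5) ℂ)).toRingHom =
        eval ![y 0, y 1, 0, y 3, z] := by
      ext i
      · simp
      · fin_cases i <;> simp <;> rfl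
    rw [show eval (Fin.snoc y z : Fin 5 → ℂ) G' = eval ![y 0, y 1, 0, y 3, z] G from
      RingHom.congr_fun e' G]
    simpa [gram₁₁, gram₁₂, gram₂₂, detA, detN, hu, hv, huv] using e
  obtain ⟨p, hp⟩ := Ideal.mem_span_singleton'.mp h1
  obtain ⟨q, hq⟩ := Ideal.mem_span_singleton'.mp h2
  refine ⟨p - q * (X 2 * X 3), mul_left_cancel₀ detA_ne_zero ?_⟩
  have hG : G = p * X 2 + q * (X 4 ^ 2 - X 0 * X 1) := by
    simp only [map_mul, rename_X] at hq
    change q * (X 4 ^ 2 - X 0 * X 1) = G' at hq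
    rw [hp, hq]
    ring
  rw [← h, hG]
  simp only [map_add, map_sub, map_mul, map_pow]
  simp only [invariants, aeval_X]
  simp only [Matrix.cons_val]
  linear_combination aeval ![gram₁₁, gram₂₂, detA, detN, gram₁₂] q * gram_det

/-- The invariants of `SL₂` are generated by `det A`, `det N` and the entries of `Aᵀ N A`. -/
theorem exists_invariants_eq {h : Pairs} (hr : raising h = 0) (hl : lowering h = 0) :
    ∃ G, invariants G = h := by
  obtain ⟨k, G, hG⟩ := exists_eval_eq_pow_mul_eval_slice h
  have key : invariants G = detA ^ k * h := by
    -- The extra factor removes the points that the reduction to the slice does not reach.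
    refine mul_left_cancel₀ (mul_ne_zero (X_ne_zero (2 : Fin 7)) detA_ne_zero) ?_
    refine MvPolynomial.funext fun x => ?_
    simp only [map_mul, map_pow, eval_X]
    by_cases h2 : x 2 = 0
    · simp [h2]
    by_cases ha : eval x detA = 0
    · simp [ha]
    rw [eval_invariants, hG _ ha, eval_eq_eval_slice hr hl x h2 ha]
    rfl
  clear hG hr hl
  induction k generalizing G with
  | zero => exact ⟨G, by simpa using key⟩
  | succ k ih =>
    rw [pow_succ', mul_assoc] at key
    obtain ⟨G', hG'⟩ := exists_invariants_eq_of_detA_mul key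
    exact ih G' hG'

/-! ### The quadric as the invariants of determinant `±1`. -/

/-- The homomorphism from the polynomial ring whose image is the ring of invariants of the group of
matrices of determinant `±1`. -/
noncomputable def toPairs : MvPolynomial (Fin 5) ℂ →ₐ[ℂ] Pairs :=
  invariants.comp (aeval ![X 0, X 1, -X 2 ^ 2, X 3, X 4])

theorem toPairs_X (i : Fin 5) :
    toPairs (X i) = (![gram₁₁, gram₂₂, -detA ^ 2, detN, gram₁₂] : Fin 5 → Pairs) i := by
  fin_cases i <;> simp [toPairs, invariants]

theorem exists_invariants_eq_toPairs_add (G : MvPolynomial (Fin 5) ℂ) :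
    ∃ r r', invariants G = toPairs r + detA * toPairs r' := by
  induction G using MvPolynomial.induction_on with
  | C a => exact ⟨C a, 0, by simp [invariants, toPairs]⟩
  | add p q hp hq =>
    obtain ⟨p₀, p₁, hp⟩ := hp
    obtain ⟨q₀, q₁, hq⟩ := hq
    exact ⟨p₀ + q₀, p₁ + q₁, by simp only [map_add, hp, hq]; ring⟩
  | mul_X p i hp =>
    obtain ⟨p₀, p₁, hp⟩ := hp
    by_cases hi : i = 2
    · subst hi
      -- A second factor `det A` is absorbed through `(det A)² = toPairs (-X 2)`.
      refine ⟨-(X 2 * p₁), p₀, ?_⟩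
      rw [map_mul, hp, map_neg, map_mul, toPairs_X]
      simp only [invariants, aeval_X, Matrix.cons_val]
      ring
    · refine ⟨p₀ * X i, p₁ * X i, ?_⟩
      have : invariants (X i) = toPairs (X i) := by
        rw [toPairs_X]
        fin_cases i <;> simp [invariants] at hi ⊢
      rw [map_mul, hp, map_mul, map_mul, this]
      ring

theorem toPairs_relation : toPairs (X 0 * X 1 + X 2 * X 3 - X 4 ^ 2) = 0 := by
  simp only [map_add, map_sub, map_mul, map_pow, toPairs_X, Matrix.cons_val]
  linear_combination gram_det

theorem mem_span_of_toPairs_eq_zero {G : MvPolynomial (Fin 5) ℂ} (hG : toPairs G = 0) :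
    G ∈ Ideal.span {(X 0 * X 1 + X 2 * X 3 - X 4 ^ 2 : MvPolynomial (Fin 5) ℂ)} := by
  have hQ : (X 0 * X 1 + X 2 * X 3 : MvPolynomial (Fin 4) ℂ) ≠ 0 := by
    intro h
    have := congrArg (eval ![1, 1, 0, 0]) h
    simp at this
  have h := mem_span_of_eval_eq_zero (P := X 2) (X_ne_zero 2) hQ G fun y z hz hy => by
    simp only [map_add, map_mul, eval_X] at hz hy
    obtain ⟨a, ha⟩ := IsAlgClosed.exists_pow_nat_eq (-y 2) two_pos
    have ha0 : a ≠ 0 := by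
      rintro rfl
      apply hy
      linear_combination ha
    -- A pair with `A = diag(1, a)`, `a² = -y 2`, lying over the given point of the quadric; hence
    -- the restriction to `y 2 ≠ 0`.
    have e := congrArg (eval ![1, 0, 0, a, y 0, z / a, y 1 / a ^ 2]) hG
    have e' : (eval ![1, 0, 0, a, y 0, z / a, y 1 / a ^ 2]).comp toPairs.toRingHom =
        eval (Fin.snoc y z : Fin 5 → ℂ) := by
      ext i
      · simp
      · change eval _ (toPairs (X i)) = _
        rw [toPairs_X, eval_X]
        have hN : y 0 * (y 1 / a ^ 2) - (z / a) ^ 2 = y 3 := by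
          field_simp
          linear_combination -hz - y 3 * ha
        have h0 : (Fin.snoc y z : Fin 5 → ℂ) 0 = y 0 := rfl
        have h1 : (Fin.snoc y z : Fin 5 → ℂ) 1 = y 1 := rfl
        have h2 : (Fin.snoc y z : Fin 5 → ℂ) 2 = -a ^ 2 := by
          change y 2 = _
          linear_combination ha
        have h3 : (Fin.snoc y z : Fin 5 → ℂ) 3 = y 3 := rfl
        have h4 : (Fin.snoc y z : Fin 5 → ℂ) 4 = z := rfl
        fin_cases i <;> simp [gram₁₁, gram₁₂, gram₂₂, detA, detN, ha0, hN, h0, h1, h2, h3, h4]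
    have e'' := RingHom.congr_fun e' G
    rw [← e'']
    simpa using e
  simp only [map_add, map_mul, rename_X] at h
  rw [← Ideal.span_singleton_neg, neg_sub]
  exact h

/-- The action of `diag(1, -1)`. -/
noncomputable def reflection : Pairs →ₐ[ℂ] Pairs :=
  aeval ![X 0, X 1, -X 2, -X 3, X 4, -X 5, X 6]

theorem reflection_detA : reflection detA = -detA := by
  simp [reflection, detA]
  ring

theorem reflection_toPairs (G : MvPolynomial (Fin 5) ℂ) : reflection (toPairs G) = toPairs G := by
  have hX (i : Fin 7) : reflection (X i) =
      (![X 0, X 1, -X 2, -X 3, X 4, -X 5, X 6] : Fin 7 → Pairs) i := aeval_X _ i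
  have : reflection.comp toPairs = toPairs := by
    refine algHom_ext fun i => ?_
    rw [AlgHom.comp_apply, toPairs_X]
    fin_cases i <;> simp [hX, map_ofNat, gram₁₁, gram₁₂, gram₂₂, detA, detN] <;> ring
  exact AlgHom.congr_fun this G

end FiveVariableQuadric

/-! ### The splitting. -/

/-- An injective algebra map whose range has a complementary submodule has a linear retraction. -/
theorem isDirectSummandInclusion_of_isCompl {R S : Type u} [CommRing R] [CommRing S] [Algebra R S]
    (hinj : Function.Injective (algebraMap R S)) (K : Submodule R S)
    (hK : IsCompl (LinearMap.range (Algebra.linearMap R S)) K) :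
    IsDirectSummandInclusion R S := by
  let e := LinearEquiv.ofInjective (Algebra.linearMap R S) hinj
  refine ⟨hinj, e.symm.toLinearMap ∘ₗ Submodule.projectionOnto _ _ hK, fun r => ?_⟩
  have h := Submodule.projectionOnto_apply_left hK (e r)
  rw [LinearMap.comp_apply]
  change e.symm (Submodule.projectionOnto _ _ hK (e r : S)) = r
  rw [h, e.symm_apply_apply]

namespace FiveVariableQuadric

/-- The inclusion of the quadric as the ring of invariants. -/
noncomputable def inclusion : FiveVariableQuadric →+* Pairs :=
  Ideal.Quotient.lift _ toPairs.toRingHom fun G hG => by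
    obtain ⟨p, rfl⟩ := Ideal.mem_span_singleton'.mp hG
    exact (map_mul toPairs _ _).trans (by rw [toPairs_relation, mul_zero])

theorem inclusion_mk (G : MvPolynomial (Fin 5) ℂ) :
    inclusion (Ideal.Quotient.mk _ G) = toPairs G := rfl

theorem inclusion_injective : Function.Injective inclusion := by
  rw [injective_iff_map_eq_zero]
  intro r hr
  obtain ⟨G, rfl⟩ := Ideal.Quotient.mk_surjective r
  exact Ideal.Quotient.eq_zero_iff_mem.mpr (mem_span_of_toPairs_eq_zero hr)

theorem raising_inclusion (r : FiveVariableQuadric) : raising (inclusion r) = 0 := by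
  obtain ⟨G, rfl⟩ := Ideal.Quotient.mk_surjective r
  exact raising_invariants _

theorem lowering_inclusion (r : FiveVariableQuadric) : lowering (inclusion r) = 0 := by
  obtain ⟨G, rfl⟩ := Ideal.Quotient.mk_surjective r
  exact lowering_invariants _

theorem reflection_inclusion (r : FiveVariableQuadric) :
    reflection (inclusion r) = inclusion r := by
  obtain ⟨G, rfl⟩ := Ideal.Quotient.mk_surjective r
  exact reflection_toPairs _

theorem raising_detA : raising detA = 0 := by
  simpa [invariants] using raising_invariants (X 2)

theorem lowering_detA : lowering detA = 0 := by
  simpa [invariants] using lowering_invariants (X 2)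

theorem exists_eq_inclusion_add (s : Pairs) :
    ∃ r g g' r', s = inclusion r + (raising g + lowering g' + detA * inclusion r') := by
  obtain ⟨g, g', h, hr, hl, rfl⟩ := exists_eq_raising_add_lowering_add s
  obtain ⟨G, rfl⟩ := exists_invariants_eq hr hl
  obtain ⟨p, p', e⟩ := exists_invariants_eq_toPairs_add G
  refine ⟨Ideal.Quotient.mk _ p, g, g', Ideal.Quotient.mk _ p', ?_⟩
  rw [inclusion_mk, inclusion_mk, e]
  ring

/-- The difference `r - det A · r'` is both invariant and in the sum of the ranges, hence zero. The
reflection fixes `r` and negates `det A · r'`, so adding the two equations gives `2r = 0`. -/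
theorem inclusion_eq_zero_of_eq {r r' : FiveVariableQuadric} {g g' : Pairs}
    (h : inclusion r = raising g + lowering g' + detA * inclusion r') : inclusion r = 0 := by
  have h1 : inclusion r - detA * inclusion r' = 0 := by
    refine eq_zero_of_eq_raising_add_lowering (g := g) (g' := g') ?_ ?_ (by rw [h]; ring)
    · rw [map_sub, Derivation.leibniz, raising_inclusion, raising_inclusion, raising_detA]
      simp
    · rw [map_sub, Derivation.leibniz, lowering_inclusion, lowering_inclusion, lowering_detA]
      simp
  have h2 := congrArg reflection h1
  rw [map_sub, map_mul, reflection_inclusion, reflection_inclusion, reflection_detA, map_zero] at h2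
  have h3 : (2 : Pairs) * inclusion r = 0 := by linear_combination h1 + h2
  exact (mul_eq_zero.mp h3).resolve_left two_ne_zero

end FiveVariableQuadric

open FiveVariableQuadric in
theorem mainTheorem6 : IsDirectSummandOfRegularRing FiveVariableQuadric := by
  let _ : Algebra FiveVariableQuadric Pairs := inclusion.toAlgebra
  let K : Submodule FiveVariableQuadric Pairs :=
    { carrier := {s | ∃ g g' r, s = raising g + lowering g' + detA * inclusion r}
      add_mem' := by
        rintro _ _ ⟨g₁, g₁', r₁, rfl⟩ ⟨g₂, g₂', r₂, rfl⟩
        exact ⟨g₁ + g₂, g₁' + g₂', r₁ + r₂, by simp only [map_add]; ring⟩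
      zero_mem' := ⟨0, 0, 0, by simp⟩
      smul_mem' := by
        rintro r _ ⟨g, g', r', rfl⟩
        -- Derivations that kill `R` are `R`-linear, so scalars move inside them.
        refine ⟨inclusion r * g, inclusion r * g', r * r', ?_⟩
        change inclusion r * _ = _
        rw [Derivation.leibniz, Derivation.leibniz, raising_inclusion, lowering_inclusion, map_mul]
        simp only [smul_eq_mul]
        ring }
  refine ⟨Pairs, inferInstance, inferInstance, inferInstance,
    isDirectSummandInclusion_of_isCompl inclusion_injective K ⟨?_, ?_⟩⟩
  · rw [Submodule.disjoint_def]
    rintro _ ⟨r, rfl⟩ ⟨g, g', r', h⟩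
    exact inclusion_eq_zero_of_eq h
  · rw [codisjoint_iff, eq_top_iff]
    rintro s -
    obtain ⟨r, g, g', r', rfl⟩ := exists_eq_inclusion_add s
    exact Submodule.add_mem_sup ⟨r, rfl⟩ ⟨g, g', r', rfl⟩
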